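/- Let $m\in\mathbb{N}$ and let $(\Omega,\mathfrak F,\mathsf P)$ be a probability space. Let $S_{n,k}$ be a double array of $\mathbb{R}^m$-valued random vectors on it, and let $N_n$ be random variables with values in the index set $\{0,1,2,\dots\}$ of $k$, such that for each $n,k$ the variable $N_n$ and the vector $S_{n,k}$ are independent. Let $a_{n,k}\in\mathbb{R}^m$, $b_{n,k}>0$, $d_n>0$ and $c_n\in\mathbb{R}^m$ be non-random, and put $$Y_{n,k}=\frac{S_{n,k}-a_{n,k}}{b_{n,k}},\quad Z_n=\frac{S_{n,N_n}-c_n}{d_n},\quad U_n=\frac{b_{n,N_n}}{d_n},\quad V_n=\frac{a_{n,N_n}-c_n}{d_n},\quad W_n=(U_n,V_n).$$ Let $Y$ be an $\mathbb{R}^m$-valued random vector with characteristic function $h$, and let $h_{n,k}$ be the characteristic function of $Y_{n,k}$. Call a family of random vectors weakly relatively compact if each sequence of its elements contains a weakly convergent subsequence (in $\mathbb{R}^m$ this is the same as tightness). For a random vector $Z$ in $\mathbb{R}^m$ with characteristic function $f$ let $\mathcal{W}(Z|Y)$ be the set of (laws of) random vectors $(U,V)$, $U\in\mathbb{R}$,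 $V\in\mathbb{R}^m$, with $\mathsf P(U\ge 0)=1$ and $$f(t)=\mathsf E\,h(Ut)\,e^{i\langle t,V\rangle},\qquad t\in\mathbb{R}^m,$$ equivalently, $Z\stackrel{d}{=}U\cdot Y+V$ with $Y$ independent of $(U,V)$. Let $\Lambda$ be any metric on the laws of $(m+1)$-dimensional random vectors that metrizes weak convergence (e.g. the Lévy–Prokhorov metric). Theorem 2. Assume that the family $\{U_n\}$ is weakly relatively compact and that the coherency condition holds: for any $T\in(0,\infty)$, $$\lim_{n\to\infty}\mathsf E\sup_{\|t\|\le T}\bigl|h_{n,N_n}(t)-h(t)\bigr|=0.$$ Then, for every choice of the centering vectors $c_n\in\mathbb{R}^m$ and every law of $Z$, one has $Z_n\Rightarrow Z$ as $n\to\infty$ if and only if there is a weakly relatively compact sequence $W_n^*=(U_n^*,V_n^*)\in\mathcal{W}(Z|Y)$ such that $$\lim_{n\to\infty}\Lambda(W_n^*,W_n)=0.$$ In particular, a random vector $Z$ such that $Z_n\Rightarrow Z$ with some $c_n\in\mathbb{R}^m$ exists if and only if, for some $Z$ and some $c_n\in\mathbb{R}^m$, such a sequence $W_n^*$ exists. 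-/

import Mathlib

open MeasureTheory ProbabilityTheory Filter Topology

namespace RandomIndex

/-- The law `ℒ(X)` of a random element `X`. -/
noncomputable def law {Ω F : Type*} [MeasurableSpace Ω] [MeasurableSpace F] (P : Measure Ω)
    [IsProbabilityMeasure P] (X : Ω → F) (hX : Measurable X) : ProbabilityMeasure F :=
  ⟨P.map X, Measure.isProbabilityMeasure_map hX.aemeasurable⟩

/-- Weak relative compactness of a family of laws: every sequence of its elements contains a
weakly convergent subsequence (the topology of `ProbabilityMeasure F` is that of weak
convergence). -/
def WeaklyRelativelyCompact {F ι : Type*} [MeasurableSpace F] [TopologicalSpace F]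
    [OpensMeasurableSpace F] (μ : ι → ProbabilityMeasure F) : Prop :=
  ∀ s : ℕ → ι, ∃ φ : ℕ → ℕ, StrictMono φ ∧ ∃ ν : ProbabilityMeasure F,
    Tendsto (fun j => μ (s (φ j))) atTop (𝓝 ν)

/-- `Λ` is a metric on the laws on `F` that metrizes weak convergence. -/
structure MetrizesWeakConvergence {F : Type*} [MeasurableSpace F] [TopologicalSpace F]
    [OpensMeasurableSpace F] (Λ : ProbabilityMeasure F → ProbabilityMeasure F → ℝ) : Prop where
  self : ∀ μ, Λ μ μ = 0
  eq_of_zero : ∀ μ ν, Λ μ ν = 0 → μ = ν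
  symm : ∀ μ ν, Λ μ ν = Λ ν μ
  triangle : ∀ μ ν κ, Λ μ κ ≤ Λ μ ν + Λ ν κ
  tendsto_iff : ∀ (μs : ℕ → ProbabilityMeasure F) (μ : ProbabilityMeasure F),
    Tendsto μs atTop (𝓝 μ) ↔ Tendsto (fun n => Λ (μs n) μ) atTop (𝓝 0)

section Scheme

variable {Ω : Type*} {m : ℕ}

/-- `Y_{n,k} = (S_{n,k} - a_{n,k}) / b_{n,k}`. -/
noncomputable def Yvec (S : ℕ → ℕ → Ω → EuclideanSpace ℝ (Fin m))
    (a : ℕ → ℕ → EuclideanSpace ℝ (Fin m)) (b : ℕ → ℕ → ℝ) (n k : ℕ) (ω : Ω) :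
    EuclideanSpace ℝ (Fin m) :=
  (b n k)⁻¹ • (S n k ω - a n k)

/-- `Z_n = (S_{n,N_n} - c_n) / d_n`. -/
noncomputable def Zvec (S : ℕ → ℕ → Ω → EuclideanSpace ℝ (Fin m)) (N : ℕ → Ω → ℕ)
    (c : ℕ → EuclideanSpace ℝ (Fin m)) (d : ℕ → ℝ) (n : ℕ) (ω : Ω) :
    EuclideanSpace ℝ (Fin m) :=
  (d n)⁻¹ • (S n (N n ω) ω - c n)

/-- `U_n = b_{n,N_n} / d_n`. -/
noncomputable def Uvar (b : ℕ → ℕ → ℝ) (N : ℕ → Ω → ℕ) (d : ℕ → ℝ) (n : ℕ) (ω : Ω) : ℝ :=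
  (d n)⁻¹ * b n (N n ω)

/-- `V_n = (a_{n,N_n} - c_n) / d_n`. -/
noncomputable def Vvec (a : ℕ → ℕ → EuclideanSpace ℝ (Fin m)) (N : ℕ → Ω → ℕ)
    (c : ℕ → EuclideanSpace ℝ (Fin m)) (d : ℕ → ℝ) (n : ℕ) (ω : Ω) :
    EuclideanSpace ℝ (Fin m) :=
  (d n)⁻¹ • (a n (N n ω) - c n)

/-- `W_n = (U_n, V_n)`, with `ℝ^{m+1}` written as `ℝ × ℝ^m`. -/
noncomputable def Wvec (a : ℕ → ℕ → EuclideanSpace ℝ (Fin m)) (b : ℕ → ℕ → ℝ)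
    (N : ℕ → Ω → ℕ) (c : ℕ → EuclideanSpace ℝ (Fin m)) (d : ℕ → ℝ) (n : ℕ) (ω : Ω) :
    ℝ × EuclideanSpace ℝ (Fin m) :=
  (Uvar b N d n ω, Vvec a N c d n ω)

variable [MeasurableSpace Ω]

theorem measurable_Zvec {S : ℕ → ℕ → Ω → EuclideanSpace ℝ (Fin m)} {N : ℕ → Ω → ℕ}
    (hS : ∀ n k, Measurable (S n k)) (hN : ∀ n, Measurable (N n))
    (c : ℕ → EuclideanSpace ℝ (Fin m)) (d : ℕ → ℝ) (n : ℕ) :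
    Measurable (Zvec S N c d n) := by
  have h1 : Measurable (fun p : ℕ × Ω => S n p.1 p.2) :=
    measurable_from_prod_countable_right (fun k => hS n k)
  have h2 : Measurable (fun ω => S n (N n ω) ω) :=
    h1.comp ((hN n).prodMk measurable_id)
  exact (h2.sub_const (c n)).const_smul ((d n)⁻¹)

theorem measurable_Uvar {N : ℕ → Ω → ℕ} (hN : ∀ n, Measurable (N n))
    (b : ℕ → ℕ → ℝ) (d : ℕ → ℝ) (n : ℕ) : Measurable (Uvar b N d n) :=
  (measurable_from_nat (f := fun k => (d n)⁻¹ * b n k)).comp (hN n)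

theorem measurable_Wvec {N : ℕ → Ω → ℕ} (hN : ∀ n, Measurable (N n))
    (a : ℕ → ℕ → EuclideanSpace ℝ (Fin m)) (b : ℕ → ℕ → ℝ)
    (c : ℕ → EuclideanSpace ℝ (Fin m)) (d : ℕ → ℝ) (n : ℕ) :
    Measurable (Wvec a b N c d n) :=
  (measurable_Uvar hN b d n).prodMk
    ((measurable_from_nat (f := fun k => (d n)⁻¹ • (a n k - c n))).comp (hN n))

/-- The coherency condition: for every `T > 0`,
`E sup_{‖t‖ ≤ T} |h_{n,N_n}(t) - h(t)| → 0`, where `h_{n,k}` is the characteristic function of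
`Y_{n,k}` and `h` that of `Y`; the random index is substituted into `k ↦ h_{n,k}(t)`. -/
def Coherency (P : Measure Ω) (S : ℕ → ℕ → Ω → EuclideanSpace ℝ (Fin m))
    (a : ℕ → ℕ → EuclideanSpace ℝ (Fin m)) (b : ℕ → ℕ → ℝ) (N : ℕ → Ω → ℕ)
    (lawY : ProbabilityMeasure (EuclideanSpace ℝ (Fin m))) : Prop :=
  ∀ T : ℝ, 0 < T →
    Tendsto (fun n => ∫ ω, (⨆ t : Metric.closedBall (0 : EuclideanSpace ℝ (Fin m)) T,
        ‖charFun (P.map (Yvec S a b n (N n ω))) (t : EuclideanSpace ℝ (Fin m))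
          - charFun (lawY : Measure (EuclideanSpace ℝ (Fin m))) t‖) ∂P)
      atTop (𝓝 0)

end Scheme

/-- `𝒲(Z|Y)`: the laws of the pairs `(U, V)` with `U ≥ 0` almost surely and
`f(t) = E h(U t) e^{i⟨t,V⟩}` for all `t`, where `f` and `h` are the characteristic functions of
`Z` and `Y`. -/
def mixingLaws {m : ℕ} (lawZ lawY : ProbabilityMeasure (EuclideanSpace ℝ (Fin m))) :
    Set (ProbabilityMeasure (ℝ × EuclideanSpace ℝ (Fin m))) :=
  {Q | (∀ᵐ w ∂(Q : Measure (ℝ × EuclideanSpace ℝ (Fin m))), 0 ≤ w.1) ∧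
    ∀ t : EuclideanSpace ℝ (Fin m),
      charFun (lawZ : Measure (EuclideanSpace ℝ (Fin m))) t =
        ∫ w, charFun (lawY : Measure (EuclideanSpace ℝ (Fin m))) (w.1 • t)
            * Complex.exp (((inner ℝ t w.2 : ℝ) : ℂ) * Complex.I)
          ∂(Q : Measure (ℝ × EuclideanSpace ℝ (Fin m)))}

/-- There is a weakly relatively compact sequence `W_n^*` in `𝒲(Z|Y)` with
`Λ(W_n^*, W_n) → 0`. -/
def ApproximableByMixing {m : ℕ}
    (Λ : ProbabilityMeasure (ℝ × EuclideanSpace ℝ (Fin m)) →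
      ProbabilityMeasure (ℝ × EuclideanSpace ℝ (Fin m)) → ℝ)
    (lawZ lawY : ProbabilityMeasure (EuclideanSpace ℝ (Fin m)))
    (lawW : ℕ → ProbabilityMeasure (ℝ × EuclideanSpace ℝ (Fin m))) : Prop :=
  ∃ Wstar : ℕ → ProbabilityMeasure (ℝ × EuclideanSpace ℝ (Fin m)),
    (∀ n, Wstar n ∈ mixingLaws lawZ lawY) ∧ WeaklyRelativelyCompact Wstar ∧
      Tendsto (fun n => Λ (Wstar n) (lawW n)) atTop (𝓝 0)

end RandomIndex

/-!
Given `N_n = k`, the vector `Z_n = U_n Y_{n,N_n} + V_n` is an affine image of `Y_{n,k}`, so by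
independence its characteristic function is `E h_{n,N_n}(U_n t) e^{i⟨t,V_n⟩}`
(`charFun_randomIndex`). Since `U_n` is tight, coherency allows `h_{n,N_n}` to be replaced by `h` up
to an error tending to zero (`tendsto_charFun_sub_integral`). By Lévy's theorem, `Z_n ⇒ Z` therefore
means that `E h(U_n t) e^{i⟨t,V_n⟩}` converges to the characteristic function of `Z` at every `t`.
The integrand is a bounded continuous function of `(U_n, V_n)`, so this expectation passes to weak
limits of `W_n`, and the theorem becomes a compactness statement about the sequence `W_n`.

If `W_n` is approximated by a weakly relatively compact sequence in `𝒲(Z|Y)`, then along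
subsequences both sequences have the same weak limit, and the expectations converge
(`ApproximableByMixing.tendsto_integral_mixingKernel`).

Conversely, if `Z_n ⇒ Z`, then `Z_n` is tight. The same comparison with `U = 1`, `V = 0` shows
`Y_{n,N_n} ⇒ Y`, so `Y_{n,N_n}` is tight too, hence so are `V_n = Z_n - U_n Y_{n,N_n}` and `W_n`
(`isTightMeasureSet_Wvec`). All subsequential limits of `W_n` lie in `𝒲(Z|Y)`, so the distance from
`W_n` to `𝒲(Z|Y)` tends to zero, and near-minimizers of that distance form the required sequence
(`approximableByMixing_of_tendsto`).
-/

namespace RandomIndex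

/-! ### Weak relative compactness and tightness -/

section Topology

variable {F : Type*} [MeasurableSpace F]

theorem MetrizesWeakConvergence.nonneg [TopologicalSpace F] [OpensMeasurableSpace F]
    {Λ : ProbabilityMeasure F → ProbabilityMeasure F → ℝ} (hΛ : MetrizesWeakConvergence Λ)
    (μ ν : ProbabilityMeasure F) : 0 ≤ Λ μ ν := by
  have h := hΛ.triangle μ ν μ
  rw [hΛ.self, hΛ.symm ν μ] at h
  linarith

theorem MetrizesWeakConvergence.tendsto_of_tendsto [TopologicalSpace F] [OpensMeasurableSpace F]
    {Λ : ProbabilityMeasure F → ProbabilityMeasure F → ℝ} (hΛ : MetrizesWeakConvergence Λ)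
    {μs νs : ℕ → ProbabilityMeasure F} {ν : ProbabilityMeasure F}
    (h : Tendsto (fun n => Λ (μs n) (νs n)) atTop (𝓝 0)) (hν : Tendsto νs atTop (𝓝 ν)) :
    Tendsto μs atTop (𝓝 ν) := by
  rw [hΛ.tendsto_iff] at hν ⊢
  refine squeeze_zero (fun n => hΛ.nonneg _ _) (fun n => hΛ.triangle _ (νs n) _) ?_
  simpa using h.add hν

/-- For a family indexed by `ℕ` it suffices to look at sequences of indices tending to infinity:
any other sequence of indices takes some value infinitely often. -/
theorem weaklyRelativelyCompact_of_tendsto_atTop [TopologicalSpace F] [OpensMeasurableSpace F]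
    {μ : ℕ → ProbabilityMeasure F}
    (h : ∀ s : ℕ → ℕ, Tendsto s atTop atTop → ∃ φ : ℕ → ℕ, StrictMono φ ∧
      ∃ ν : ProbabilityMeasure F, Tendsto (fun j => μ (s (φ j))) atTop (𝓝 ν)) :
    WeaklyRelativelyCompact μ := by
  intro s
  by_cases hs : ∃ k, ∃ᶠ n in atTop, s n = k
  · obtain ⟨k, hk⟩ := hs
    obtain ⟨φ, hφ, hφk⟩ := extraction_of_frequently_atTop hk
    exact ⟨φ, hφ, μ k, by simp only [hφk]; exact tendsto_const_nhds⟩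
  · push Not at hs
    refine h s ?_
    rw [← Nat.cofinite_eq_atTop]
    exact le_cofinite_iff_eventually_ne.2 (fun k => by simpa [Nat.cofinite_eq_atTop] using hs k)

variable [MetricSpace F] [SecondCountableTopology F] [BorelSpace F]

/-- The direct half of Prokhorov's theorem, in terms of sequences. -/
theorem weaklyRelativelyCompact_of_isTightMeasureSet {ι : Type*} {μ : ι → ProbabilityMeasure F}
    (h : IsTightMeasureSet (Set.range fun i => (μ i : Measure F))) :
    WeaklyRelativelyCompact μ := by
  intro s
  have hc : IsCompact (closure (Set.range μ)) :=
    isCompact_closure_of_isTightMeasureSet (h.subset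
      (by rintro _ ⟨_, ⟨i, rfl⟩, rfl⟩; exact ⟨i, rfl⟩))
  let _ : MetricSpace (ProbabilityMeasure F) := TopologicalSpace.metrizableSpaceMetric _
  obtain ⟨ν, -, φ, hφ, hν⟩ :=
    hc.tendsto_subseq (x := fun n => μ (s n)) (fun n => subset_closure (Set.mem_range_self _))
  exact ⟨φ, hφ, ν, hν⟩

/-- The converse half of Prokhorov's theorem: limits of elements of the closure are found by
replacing each by a nearby member of the family. -/
theorem WeaklyRelativelyCompact.isTightMeasureSet [CompleteSpace F] {ι : Type*}
    {μ : ι → ProbabilityMeasure F}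
    (h : WeaklyRelativelyCompact μ) :
    IsTightMeasureSet (Set.range fun i => (μ i : Measure F)) := by
  let _ : MetricSpace (ProbabilityMeasure F) := TopologicalSpace.metrizableSpaceMetric _
  have hc : IsSeqCompact (closure (Set.range μ)) := by
    intro x hx
    have hx' : ∀ n : ℕ, ∃ i, dist (x n) (μ i) < 1 / ((n : ℝ) + 1) := fun n => by
      obtain ⟨_, ⟨i, rfl⟩, hi⟩ := Metric.mem_closure_iff.1 (hx n) _ Nat.one_div_pos_of_nat
      exact ⟨i, hi⟩
    choose s hs using hx'
    obtain ⟨φ, hφ, ν, hν⟩ := h s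
    refine ⟨ν, isClosed_closure.mem_of_tendsto hν
      (.of_forall fun j => subset_closure (Set.mem_range_self _)), φ, hφ, ?_⟩
    have h0 : Tendsto (fun j => dist (μ (s (φ j))) (x (φ j))) atTop (𝓝 0) :=
      squeeze_zero (fun _ => dist_nonneg) (fun j => by rw [dist_comm]; exact (hs _).le)
        (tendsto_one_div_add_atTop_nhds_zero_nat.comp hφ.tendsto_atTop)
    exact hν.congr_dist h0
  refine (isTightMeasureSet_of_isCompact_closure hc.isCompact).subset ?_
  rintro _ ⟨i, rfl⟩
  exact ⟨μ i, Set.mem_range_self i, rfl⟩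

end Topology

/-- Tightness of a sequence of random vectors through tails that are uniformly small; the bound is
asked for all large radii so that several sequences can share one radius. -/
theorem isTightMeasureSet_range_map_iff {Ω E : Type*} [MeasurableSpace Ω] {P : Measure Ω}
    [NormedAddCommGroup E] [ProperSpace E] [MeasurableSpace E] [BorelSpace E] {X : ℕ → Ω → E}
    (hX : ∀ n, Measurable (X n)) :
    IsTightMeasureSet (Set.range fun n => P.map (X n)) ↔
      ∀ ε : ENNReal, 0 < ε → ∃ R : ℝ, ∀ r, R ≤ r → ∀ n, P {ω | r < ‖X n ω‖} ≤ ε := by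
  have hm : ∀ n (r : ℝ), P.map (X n) {x | r < ‖x‖} = P {ω | r < ‖X n ω‖} := fun n r =>
    Measure.map_apply (hX n) (measurableSet_lt measurable_const measurable_norm)
  rw [isTightMeasureSet_iff_tendsto_measure_norm_gt, ENNReal.tendsto_atTop_zero]
  simp [iSup_le_iff, hm]

/-! ### Conditioning on a random index -/

section Conditioning

variable {Ω : Type*} [MeasurableSpace Ω] {P : Measure Ω} [IsProbabilityMeasure P]

/-- Conditioning on a random index independent of each term: the expectation of `g_N(X_N)` is that
of `k ↦ E g_k(X_k)` evaluated at `k = N`. -/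
theorem integral_comp_randomIndex {F : Type*} [MeasurableSpace F] {X : ℕ → Ω → F} {N : Ω → ℕ}
    (hX : ∀ k, Measurable (X k)) (hN : Measurable N) (hind : ∀ k, IndepFun N (X k) P)
    {g : ℕ → F → ℂ} (hg : ∀ k, Measurable (g k)) {C : ℝ} (hC : ∀ k x, ‖g k x‖ ≤ C) :
    ∫ ω, g (N ω) (X (N ω) ω) ∂P = ∫ ω, (∫ ω', g (N ω) (X (N ω) ω') ∂P) ∂P := by
  have hms : ∀ k, MeasurableSet (N ⁻¹' {k}) := fun k => hN (measurableSet_singleton k)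
  have hdisj : Pairwise (Function.onFun Disjoint fun k => N ⁻¹' {k}) := fun i j hij =>
    Disjoint.preimage _ (by simpa using hij)
  have hun : (⋃ k, N ⁻¹' {k}) = Set.univ := by ext; simp
  have hm1 : Measurable fun ω => g (N ω) (X (N ω) ω) := by
    have h1 : Measurable fun p : ℕ × Ω => g p.1 (X p.1 p.2) :=
      measurable_from_prod_countable_right fun k => (hg k).comp (hX k)
    exact h1.comp (hN.prodMk measurable_id)
  have hm2 : Measurable fun ω => ∫ ω', g (N ω) (X (N ω) ω') ∂P :=
    (measurable_from_nat (f := fun k => ∫ ω', g k (X k ω') ∂P)).comp hN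
  have hi1 : Integrable (fun ω => g (N ω) (X (N ω) ω)) P :=
    .of_bound hm1.aestronglyMeasurable C (.of_forall fun ω => hC _ _)
  have hi2 : Integrable (fun ω => ∫ ω', g (N ω) (X (N ω) ω') ∂P) P :=
    .of_bound hm2.aestronglyMeasurable C (.of_forall fun ω => by
      simpa using norm_integral_le_of_norm_le_const (μ := P)
        (.of_forall fun ω' => hC (N ω) (X (N ω) ω')))
  have hs1 := hasSum_integral_iUnion hms hdisj hi1.integrableOn
  have hs2 := hasSum_integral_iUnion hms hdisj hi2.integrableOn
  rw [hun, setIntegral_univ] at hs1 hs2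
  refine hs1.unique (hs2.congr_fun ?_)
  intro k
  have e1 : ∫ ω in N ⁻¹' {k}, g (N ω) (X (N ω) ω) ∂P = ∫ ω in N ⁻¹' {k}, g k (X k ω) ∂P :=
    setIntegral_congr_fun (hms k) fun ω hω => by
      have : N ω = k := hω
      simp only [this]
  have e2 : ∫ ω in N ⁻¹' {k}, (∫ ω', g (N ω) (X (N ω) ω') ∂P) ∂P
      = ∫ ω in N ⁻¹' {k}, (∫ ω', g k (X k ω') ∂P) ∂P :=
    setIntegral_congr_fun (hms k) fun ω hω => by
      have : N ω = k := hω
      simp only [this]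
  -- Each summand factorizes, as `1_{N = k}` is independent of `g_k(X_k)`.
  let ind : ℕ → ℂ := Set.indicator {k} 1
  have hmi : Measurable ind := measurable_from_nat
  have hmul : ∀ f : Ω → ℂ, ∫ ω in N ⁻¹' {k}, f ω ∂P = ∫ ω, ind (N ω) * f ω ∂P := fun f => by
    rw [← integral_indicator (hms k)]
    refine integral_congr_ae (.of_forall fun ω => ?_)
    by_cases h : N ω = k <;> simp [ind, Set.indicator, h]
  have hindep : IndepFun (fun ω => ind (N ω)) (fun ω => g k (X k ω)) P :=
    (hind k).comp hmi (hg k)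
  rw [e1, e2, hmul, hmul, integral_mul_const]
  exact hindep.integral_fun_mul_eq_mul_integral
    (hmi.comp hN).aestronglyMeasurable ((hg k).comp (hX k)).aestronglyMeasurable

theorem charFun_randomIndex {E : Type*} [NormedAddCommGroup E] [InnerProductSpace ℝ E]
    [MeasurableSpace E] [BorelSpace E] [SecondCountableTopology E] {X : ℕ → Ω → E} {N : Ω → ℕ}
    (hX : ∀ k, Measurable (X k)) (hN : Measurable N) (hind : ∀ k, IndepFun N (X k) P)
    (u : ℕ → ℝ) (v : ℕ → E) (t : E) :
    charFun (P.map fun ω => u (N ω) • X (N ω) ω + v (N ω)) t =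
      ∫ ω, charFun (P.map (X (N ω))) (u (N ω) • t) *
        Complex.exp (((inner ℝ t (v (N ω)) : ℝ) : ℂ) * Complex.I) ∂P := by
  have hm : Measurable fun ω => u (N ω) • X (N ω) ω + v (N ω) := by
    have h1 : Measurable fun p : ℕ × Ω => u p.1 • X p.1 p.2 + v p.1 :=
      measurable_from_prod_countable_right fun k => ((hX k).const_smul (u k)).add_const (v k)
    exact h1.comp (hN.prodMk measurable_id)
  rw [charFun_apply, integral_map hm.aemeasurable (by fun_prop)]
  rw [integral_comp_randomIndex (C := 1)
    (g := fun k x => Complex.exp (((inner ℝ (u k • x + v k) t : ℝ) : ℂ) * Complex.I))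
    hX hN hind (fun k => by fun_prop) (fun k x => (Complex.norm_exp_ofReal_mul_I _).le)]
  congr with ω
  rw [charFun_apply, integral_map (hX _).aemeasurable (by fun_prop), ← integral_mul_const]
  congr with ω'
  rw [← Complex.exp_add, inner_add_left, real_inner_smul_left, real_inner_smul_right,
    real_inner_comm t (v (N ω))]
  push_cast
  ring_nf

end Conditioning

/-! ### Mixing laws and their weak limits -/

section Mixing

variable {m : ℕ}

local notation "E" => EuclideanSpace ℝ (Fin m)

/-- The integrand `(u, v) ↦ h(u t) e^{i⟨t, v⟩}` of the mixture as a bounded continuous function,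
`h` being the characteristic function of the law of `Y`. -/
noncomputable def mixingKernel (lawY : ProbabilityMeasure E) (t : E) :
    BoundedContinuousFunction (ℝ × E) ℂ :=
  BoundedContinuousFunction.ofNormedAddCommGroup
    (fun w => charFun (lawY : Measure E) (w.1 • t) *
      Complex.exp (((inner ℝ t w.2 : ℝ) : ℂ) * Complex.I))
    (by
      have := continuous_charFun (μ := (lawY : Measure E))
      fun_prop)
    1 (fun w => by
      rw [norm_mul, Complex.norm_exp_ofReal_mul_I, mul_one]
      exact norm_charFun_le_one _)

theorem tendsto_integral_mixingKernel {Q : ℕ → ProbabilityMeasure (ℝ × E)}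
    {ν : ProbabilityMeasure (ℝ × E)} (h : Tendsto Q atTop (𝓝 ν))
    (lawY : ProbabilityMeasure E) (t : E) :
    Tendsto (fun n => ∫ w, mixingKernel lawY t w ∂(Q n : Measure (ℝ × E))) atTop
      (𝓝 (∫ w, mixingKernel lawY t w ∂(ν : Measure (ℝ × E)))) :=
  (ProbabilityMeasure.tendsto_iff_forall_integral_rclike_tendsto ℂ).1 h _

theorem mem_mixingLaws_iff {lawZ lawY : ProbabilityMeasure E} {Q : ProbabilityMeasure (ℝ × E)} :
    Q ∈ mixingLaws lawZ lawY ↔ (∀ᵐ w ∂(Q : Measure (ℝ × E)), 0 ≤ w.1) ∧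
      ∀ t : E, charFun (lawZ : Measure E) t = ∫ w, mixingKernel lawY t w ∂(Q : Measure (ℝ × E)) :=
  Iff.rfl

theorem ae_fst_nonneg_of_tendsto {Q : ℕ → ProbabilityMeasure (ℝ × E)}
    {ν : ProbabilityMeasure (ℝ × E)} (h : Tendsto Q atTop (𝓝 ν))
    (hQ : ∀ n, ∀ᵐ w ∂(Q n : Measure (ℝ × E)), 0 ≤ w.1) :
    ∀ᵐ w ∂(ν : Measure (ℝ × E)), 0 ≤ w.1 := by
  have hF : IsClosed {w : ℝ × E | 0 ≤ w.1} := isClosed_le continuous_const continuous_fst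
  have h1 := ProbabilityMeasure.limsup_measure_closed_le_of_tendsto h hF
  have h2 : ∀ n, (Q n : Measure (ℝ × E)) {w : ℝ × E | 0 ≤ w.1} = 1 := fun n =>
    prob_compl_eq_zero_iff hF.measurableSet |>.1 (ae_iff.1 (hQ n))
  simp only [h2, limsup_const] at h1
  exact (prob_compl_eq_zero_iff hF.measurableSet).2 (le_antisymm prob_le_one h1)

/-- If the mixtures of `Y` with weights `W_n` have characteristic functions converging to that of
`Z`, then every subsequential weak limit of `W_n` is a mixing law for `Z`. -/
theorem mem_mixingLaws_of_tendsto {lawZ lawY : ProbabilityMeasure E}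
    {Q : ℕ → ProbabilityMeasure (ℝ × E)} {ν : ProbabilityMeasure (ℝ × E)}
    (h : Tendsto Q atTop (𝓝 ν)) (hQ : ∀ n, ∀ᵐ w ∂(Q n : Measure (ℝ × E)), 0 ≤ w.1)
    (hlim : ∀ t : E, Tendsto (fun n => ∫ w, mixingKernel lawY t w ∂(Q n : Measure (ℝ × E))) atTop
      (𝓝 (charFun (lawZ : Measure E) t))) :
    ν ∈ mixingLaws lawZ lawY :=
  mem_mixingLaws_iff.2 ⟨ae_fst_nonneg_of_tendsto h hQ, fun t =>
    tendsto_nhds_unique (hlim t) (tendsto_integral_mixingKernel h lawY t)⟩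

theorem ApproximableByMixing.tendsto_integral_mixingKernel
    {Λ : ProbabilityMeasure (ℝ × E) → ProbabilityMeasure (ℝ × E) → ℝ}
    (hΛ : MetrizesWeakConvergence Λ) {lawZ lawY : ProbabilityMeasure E}
    {lawW : ℕ → ProbabilityMeasure (ℝ × E)} (h : ApproximableByMixing Λ lawZ lawY lawW) (t : E) :
    Tendsto (fun n => ∫ w, mixingKernel lawY t w ∂(lawW n : Measure (ℝ × E))) atTop
      (𝓝 (charFun (lawZ : Measure E) t)) := by
  obtain ⟨Wstar, hmem, hcomp, hdist⟩ := h
  refine tendsto_of_subseq_tendsto fun ns hns => ?_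
  obtain ⟨φ, hφ, ν, hν⟩ := hcomp ns
  have hW : Tendsto (fun j => lawW (ns (φ j))) atTop (𝓝 ν) := by
    refine hΛ.tendsto_of_tendsto ?_ hν
    simp_rw [hΛ.symm (lawW _)]
    exact hdist.comp (hns.comp hφ.tendsto_atTop)
  -- Along this subsequence both sequences of mixing laws have the limit `ν`, and on `Wstar` the
  -- integral is constant.
  have hconst := RandomIndex.tendsto_integral_mixingKernel hν lawY t
  simp_rw [← (mem_mixingLaws_iff.1 (hmem _)).2 t] at hconst
  refine ⟨φ, ?_⟩
  rw [tendsto_nhds_unique tendsto_const_nhds hconst]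
  exact RandomIndex.tendsto_integral_mixingKernel hW lawY t

/-- Near-minimizers of `Λ(·, W_n)` over `𝒲(Z|Y)` approximate `W_n`, since every subsequence of `W_n`
has a further subsequence converging to an element of `𝒲(Z|Y)`. -/
theorem approximableByMixing_of_tendsto
    {Λ : ProbabilityMeasure (ℝ × E) → ProbabilityMeasure (ℝ × E) → ℝ}
    (hΛ : MetrizesWeakConvergence Λ) {lawZ lawY : ProbabilityMeasure E}
    {lawW : ℕ → ProbabilityMeasure (ℝ × E)} (hcomp : WeaklyRelativelyCompact lawW)
    (hpos : ∀ n, ∀ᵐ w ∂(lawW n : Measure (ℝ × E)), 0 ≤ w.1)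
    (hlim : ∀ t : E, Tendsto (fun n => ∫ w, mixingKernel lawY t w ∂(lawW n : Measure (ℝ × E)))
      atTop (𝓝 (charFun (lawZ : Measure E) t))) :
    ApproximableByMixing Λ lawZ lawY lawW := by
  have hsub : ∀ s : ℕ → ℕ, Tendsto s atTop atTop → ∃ φ : ℕ → ℕ, StrictMono φ ∧
      ∃ ν ∈ mixingLaws lawZ lawY, Tendsto (fun j => lawW (s (φ j))) atTop (𝓝 ν) := by
    intro s hs
    obtain ⟨φ, hφ, ν, hν⟩ := hcomp s
    exact ⟨φ, hφ, ν, mem_mixingLaws_of_tendsto hν (fun _ => hpos _)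
      fun t => (hlim t).comp (hs.comp hφ.tendsto_atTop), hν⟩
  have hne : Nonempty (mixingLaws lawZ lawY) := by
    obtain ⟨-, -, ν, hν, -⟩ := hsub id tendsto_id
    exact ⟨ν, hν⟩
  let g : ℕ → ℝ := fun n => ⨅ Q : mixingLaws lawZ lawY, Λ Q (lawW n)
  have hbdd : ∀ n, BddBelow (Set.range fun Q : mixingLaws lawZ lawY => Λ Q (lawW n)) := fun n =>
    ⟨0, by rintro _ ⟨Q, rfl⟩; exact hΛ.nonneg _ _⟩
  have hg : Tendsto g atTop (𝓝 0) := by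
    refine tendsto_of_subseq_tendsto fun ns hns => ?_
    obtain ⟨φ, -, ν, hνmem, hν⟩ := hsub ns hns
    refine ⟨φ, squeeze_zero (fun n => Real.iInf_nonneg fun Q => hΛ.nonneg _ _)
      (fun j => ciInf_le (hbdd _) ⟨ν, hνmem⟩) ?_⟩
    simp_rw [hΛ.symm ν]
    exact (hΛ.tendsto_iff _ _).1 hν
  have hex : ∀ n : ℕ, ∃ Q : mixingLaws lawZ lawY, Λ Q (lawW n) < g n + 1 / ((n : ℝ) + 1) := fun n =>
    exists_lt_of_ciInf_lt (lt_add_of_pos_right _ Nat.one_div_pos_of_nat)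
  choose Q hQ using hex
  have hdist : Tendsto (fun n => Λ (Q n) (lawW n)) atTop (𝓝 0) :=
    squeeze_zero (fun n => hΛ.nonneg _ _) (fun n => (hQ n).le)
      (by simpa using hg.add tendsto_one_div_add_atTop_nhds_zero_nat)
  refine ⟨fun n => Q n, fun n => (Q n).2, weaklyRelativelyCompact_of_tendsto_atTop fun s hs => ?_,
    hdist⟩
  obtain ⟨φ, hφ, ν, -, hν⟩ := hsub s hs
  exact ⟨φ, hφ, ν, hΛ.tendsto_of_tendsto (hdist.comp (hs.comp hφ.tendsto_atTop)) hν⟩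

/-! ### Randomly indexed vectors under coherency -/

section Scheme

variable {Ω : Type*} {S : ℕ → ℕ → Ω → EuclideanSpace ℝ (Fin m)}
  {a : ℕ → ℕ → EuclideanSpace ℝ (Fin m)}
  {b : ℕ → ℕ → ℝ} {N : ℕ → Ω → ℕ} {d : ℕ → ℝ} {c : ℕ → EuclideanSpace ℝ (Fin m)}
  {lawY : ProbabilityMeasure (EuclideanSpace ℝ (Fin m))}

theorem Zvec_eq (hb : ∀ n k, 0 < b n k) (n : ℕ) (ω : Ω) :
    Zvec S N c d n ω = Uvar b N d n ω • Yvec S a b n (N n ω) ω + Vvec a N c d n ω := by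
  simp only [Zvec, Uvar, Yvec, Vvec]
  rw [smul_smul, mul_assoc, mul_inv_cancel₀ (hb _ _).ne', mul_one, ← smul_add, sub_add_sub_cancel]

variable [MeasurableSpace Ω] {P : Measure Ω}

theorem measurable_Yvec (hS : ∀ n k, Measurable (S n k)) (n k : ℕ) :
    Measurable (Yvec S a b n k) :=
  ((hS n k).sub_const _).const_smul ((b n k)⁻¹)

theorem measurable_Yvec_randomIndex (hS : ∀ n k, Measurable (S n k)) (hN : ∀ n, Measurable (N n))
    (n : ℕ) : Measurable fun ω => Yvec S a b n (N n ω) ω :=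
  (measurable_from_prod_countable_right (f := fun p : ℕ × Ω => Yvec S a b n p.1 p.2)
    (fun k => measurable_Yvec hS n k)).comp ((hN n).prodMk measurable_id)

theorem indepFun_Yvec {n k : ℕ} (h : IndepFun (N n) (S n k) P) :
    IndepFun (N n) (Yvec S a b n k) P :=
  h.comp (φ := id) (ψ := fun x => (b n k)⁻¹ • (x - a n k)) measurable_id (by fun_prop)

/-- `W_n = (U_n, V_n)` inherits tightness from `U_n`, `Y_{n,N_n}` and `Z_n`, because
`V_n = Z_n - U_n Y_{n,N_n}`. -/
theorem isTightMeasureSet_Wvec (hS : ∀ n k, Measurable (S n k)) (hb : ∀ n k, 0 < b n k)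
    (hN : ∀ n, Measurable (N n))
    (hU : IsTightMeasureSet (Set.range fun n => P.map (Uvar b N d n)))
    (hY : IsTightMeasureSet (Set.range fun n => P.map fun ω => Yvec S a b n (N n ω) ω))
    (hZ : IsTightMeasureSet (Set.range fun n => P.map (Zvec S N c d n))) :
    IsTightMeasureSet (Set.range fun n => P.map (Wvec a b N c d n)) := by
  rw [isTightMeasureSet_range_map_iff (fun n => measurable_Uvar hN b d n)] at hU
  rw [isTightMeasureSet_range_map_iff (measurable_Yvec_randomIndex hS hN)] at hY
  rw [isTightMeasureSet_range_map_iff (fun n => measurable_Zvec hS hN c d n)] at hZ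
  refine (isTightMeasureSet_range_map_iff fun n => measurable_Wvec hN a b c d n).2 fun ε hε => ?_
  have hε3 : 0 < ε / 3 := ENNReal.div_pos hε.ne' (by simp)
  obtain ⟨R₁, h₁⟩ := hU _ hε3
  obtain ⟨R₂, h₂⟩ := hY _ hε3
  obtain ⟨R₃, h₃⟩ := hZ _ hε3
  let R := max (max R₁ 0) (max R₂ R₃)
  have hR0 : 0 ≤ R := (le_max_right R₁ 0).trans (le_max_left _ _)
  have hR₁ : R₁ ≤ R := (le_max_left R₁ 0).trans (le_max_left _ _)
  have hR₂ : R₂ ≤ R := (le_max_left R₂ R₃).trans (le_max_right _ _)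
  have hR₃ : R₃ ≤ R := (le_max_right R₂ R₃).trans (le_max_right _ _)
  refine ⟨R + R * R, fun r hr n => ?_⟩
  have hsub : {ω | r < ‖Wvec a b N c d n ω‖} ⊆ {ω | R < ‖Uvar b N d n ω‖} ∪
      {ω | R < ‖Yvec S a b n (N n ω) ω‖} ∪ {ω | R < ‖Zvec S N c d n ω‖} := by
    intro ω hω
    by_contra hcon
    simp only [Set.mem_union, Set.mem_ofPred_eq, not_or, not_lt] at hcon
    obtain ⟨⟨hu, hy⟩, hz⟩ := hcon
    have hV : ‖Vvec a N c d n ω‖ ≤ R + R * R := by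
      rw [eq_sub_of_add_eq' (Zvec_eq (a := a) hb n ω).symm]
      refine (norm_sub_le _ _).trans (add_le_add hz ?_)
      rw [norm_smul]
      exact mul_le_mul hu hy (norm_nonneg _) hR0
    refine absurd (hr.trans_lt hω) (not_lt.2 ?_)
    exact max_le (hu.trans (le_add_of_nonneg_right (mul_nonneg hR0 hR0))) hV
  calc P {ω | r < ‖Wvec a b N c d n ω‖}
      ≤ ε / 3 + ε / 3 + ε / 3 := (measure_mono hsub).trans <| (measure_union_le _ _).trans <|
        add_le_add ((measure_union_le _ _).trans (add_le_add (h₁ R hR₁ n) (h₂ R hR₂ n)))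
          (h₃ R hR₃ n)
    _ = ε := ENNReal.add_thirds ε

variable [IsProbabilityMeasure P]

theorem integral_mixingKernel_law_Wvec (hN : ∀ n, Measurable (N n)) (t : E) (n : ℕ) :
    ∫ w, mixingKernel lawY t w
        ∂(law P (Wvec a b N c d n) (measurable_Wvec hN a b c d n) : Measure (ℝ × E)) =
      ∫ ω, charFun (lawY : Measure E) (Uvar b N d n ω • t) *
        Complex.exp (((inner ℝ t (Vvec a N c d n ω) : ℝ) : ℂ) * Complex.I) ∂P :=
  integral_map (measurable_Wvec hN a b c d n).aemeasurable
    (mixingKernel lawY t).continuous.aestronglyMeasurable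

/-- The error made by replacing the characteristic function of `Y_{n,N_n}` given `N_n` by `h` at
arguments `u_n(N_n) t` tends to zero when `u_n(N_n)` is tight: on `|u_n(N_n)| ≤ R` it is at most
the supremum over `‖s‖ ≤ R‖t‖` in the coherency condition. -/
theorem tendsto_integral_norm_charFun_sub (hS : ∀ n k, Measurable (S n k))
    (hN : ∀ n, Measurable (N n))
    (hcoh : Coherency P S a b N lawY) {u : ℕ → ℕ → ℝ}
    (hu : IsTightMeasureSet (Set.range fun n => P.map fun ω => u n (N n ω))) (t : E) :
    Tendsto (fun n => ∫ ω, ‖charFun (P.map (Yvec S a b n (N n ω))) (u n (N n ω) • t) -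
      charFun (lawY : Measure E) (u n (N n ω) • t)‖ ∂P) atTop (𝓝 0) := by
  have hP : ∀ n k, IsProbabilityMeasure (P.map (Yvec S a b n k)) := fun n k =>
    Measure.isProbabilityMeasure_map (measurable_Yvec hS n k).aemeasurable
  let D : ℕ → ℕ → E → ℝ := fun n k s =>
    ‖charFun (P.map (Yvec S a b n k)) s - charFun (lawY : Measure E) s‖
  have hD2 : ∀ n k s, D n k s ≤ 2 := fun n k s =>
    (norm_sub_le _ _).trans ((add_le_add (norm_charFun_le_one _) (norm_charFun_le_one _)).trans
      (by norm_num))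
  have hint : ∀ (n : ℕ) (f : ℕ → ℝ), (∀ k, 0 ≤ f k) → (∀ k, f k ≤ 2) →
      Integrable (fun ω => f (N n ω)) P := fun n f h0 h2 =>
    .of_bound ((measurable_from_nat (f := f)).comp (hN n)).aestronglyMeasurable 2
      (.of_forall fun ω => by rw [Real.norm_of_nonneg (h0 _)]; exact h2 _)
  refine tendsto_order.2 ⟨fun x hx => .of_forall fun n => hx.trans_le
    (integral_nonneg fun ω => norm_nonneg _), fun ε hε => ?_⟩
  obtain ⟨R, hR⟩ := (isTightMeasureSet_range_map_iff fun n =>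
    (measurable_from_nat (f := u n)).comp (hN n)).1 hu (ENNReal.ofReal (ε / 4)) (by simpa)
  let r := max R 0
  have hr0 : 0 ≤ r := le_max_right _ _
  -- The summand `1` makes the radius positive even when `t = 0`.
  let T := r * ‖t‖ + 1
  have hT : 0 < T := by positivity
  let G : ℕ → ℕ → ℝ := fun n k => ⨆ s : Metric.closedBall (0 : E) T, D n k s
  have hGbdd : ∀ n k, BddAbove (Set.range fun s : Metric.closedBall (0 : E) T => D n k s) :=
    fun n k => ⟨2, by rintro _ ⟨s, rfl⟩; exact hD2 _ _ _⟩
  have hG0 : ∀ n k, 0 ≤ G n k := fun n k => Real.iSup_nonneg fun s => norm_nonneg _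
  have hG2 : ∀ n k, G n k ≤ 2 := fun n k => Real.iSup_le (fun s => hD2 _ _ _) (by norm_num)
  filter_upwards [(tendsto_order.1 (hcoh T hT)).2 (ε / 2) (by positivity)] with n hn
  let A : Set Ω := {ω | r < ‖u n (N n ω)‖}
  have hA : MeasurableSet A := measurableSet_lt measurable_const
    ((measurable_from_nat (f := u n)).comp (hN n)).norm
  have hPA : P.real A ≤ ε / 4 :=
    ENNReal.toReal_le_of_le_ofReal (by positivity) (hR r (le_max_left _ _) n)
  have hiG : Integrable (fun ω => G n (N n ω)) P := hint n (G n) (hG0 n) (hG2 n)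
  have hiA : Integrable (A.indicator fun _ => (2 : ℝ)) P := (integrable_const 2).indicator hA
  have hle : ∀ ω, D n (N n ω) (u n (N n ω) • t) ≤ G n (N n ω) + A.indicator (fun _ => 2) ω := by
    intro ω
    by_cases hω : ω ∈ A
    · rw [Set.indicator_of_mem hω]
      linarith [hD2 n (N n ω) (u n (N n ω) • t), hG0 n (N n ω)]
    · rw [Set.indicator_of_notMem hω, add_zero]
      have hmem : u n (N n ω) • t ∈ Metric.closedBall (0 : E) T := by
        have h1 : ‖u n (N n ω)‖ ≤ r := not_lt.1 hω
        have h2 := mul_le_mul_of_nonneg_right h1 (norm_nonneg t)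
        rw [mem_closedBall_zero_iff, norm_smul]
        exact h2.trans (by simp [T])
      exact le_ciSup (hGbdd n (N n ω)) ⟨_, hmem⟩
  calc ∫ ω, D n (N n ω) (u n (N n ω) • t) ∂P
      ≤ ∫ ω, (G n (N n ω) + A.indicator (fun _ => 2) ω) ∂P :=
        integral_mono (hint n (fun k => D n k (u n k • t)) (fun _ => norm_nonneg _)
          fun _ => hD2 _ _ _) (hiG.add hiA) hle
    _ = ∫ ω, G n (N n ω) ∂P + P.real A * 2 := by
        rw [integral_add hiG hiA, integral_indicator_const _ hA, smul_eq_mul]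
    _ < ε := by linarith [show ∫ ω, G n (N n ω) ∂P < ε / 2 from hn]

/-- Under coherency, `u_n(N_n) Y_{n,N_n} + v_n(N_n)` has asymptotically the same characteristic
function as the mixture of `Y` with weights `(u_n(N_n), v_n(N_n))`. -/
theorem tendsto_charFun_sub_integral (hS : ∀ n k, Measurable (S n k)) (hN : ∀ n, Measurable (N n))
    (hind : ∀ n k, IndepFun (N n) (S n k) P)
    (hcoh : Coherency P S a b N lawY) {u : ℕ → ℕ → ℝ} (v : ℕ → ℕ → E)
    (hu : IsTightMeasureSet (Set.range fun n => P.map fun ω => u n (N n ω))) (t : E) :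
    Tendsto (fun n =>
      charFun (P.map fun ω => u n (N n ω) • Yvec S a b n (N n ω) ω + v n (N n ω)) t -
      ∫ ω, charFun (lawY : Measure E) (u n (N n ω) • t) *
        Complex.exp (((inner ℝ t (v n (N n ω)) : ℝ) : ℂ) * Complex.I) ∂P) atTop (𝓝 0) := by
  have hP : ∀ n k, IsProbabilityMeasure (P.map (Yvec S a b n k)) := fun n k =>
    Measure.isProbabilityMeasure_map (measurable_Yvec hS n k).aemeasurable
  refine squeeze_zero_norm (fun n => ?_) (tendsto_integral_norm_charFun_sub hS hN hcoh hu t)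
  have hint : ∀ f : ℕ → E → ℂ, (∀ k s, ‖f k s‖ ≤ 1) → Integrable (fun ω =>
      f (N n ω) (u n (N n ω) • t) *
        Complex.exp (((inner ℝ t (v n (N n ω)) : ℝ) : ℂ) * Complex.I)) P := fun f hf =>
    .of_bound ((measurable_from_nat (f := fun k => f k (u n k • t) *
        Complex.exp (((inner ℝ t (v n k) : ℝ) : ℂ) * Complex.I))).comp
          (hN n)).aestronglyMeasurable 1
      (.of_forall fun ω => by
        rw [norm_mul, Complex.norm_exp_ofReal_mul_I, mul_one]
        exact hf _ _)
  rw [charFun_randomIndex (measurable_Yvec hS n) (hN n) (fun k => indepFun_Yvec (hind n k))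
    (u n) (v n) t, ← integral_sub
      (hint (fun k => charFun (P.map (Yvec S a b n k))) fun _ _ => norm_charFun_le_one _)
      (hint (fun _ => charFun (lawY : Measure E)) fun _ _ => norm_charFun_le_one _)]
  refine (norm_integral_le_integral_norm _).trans_eq (integral_congr_ae (.of_forall fun ω => ?_))
  simp only [← sub_mul]
  rw [norm_mul, Complex.norm_exp_ofReal_mul_I, mul_one]

theorem isTightMeasureSet_Yvec_randomIndex (hS : ∀ n k, Measurable (S n k))
    (hN : ∀ n, Measurable (N n)) (hind : ∀ n k, IndepFun (N n) (S n k) P)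
    (hcoh : Coherency P S a b N lawY) :
    IsTightMeasureSet (Set.range fun n => P.map fun ω => Yvec S a b n (N n ω) ω) := by
  have hprob : ∀ n, IsProbabilityMeasure (P.map fun ω => Yvec S a b n (N n ω) ω) := fun n =>
    Measure.isProbabilityMeasure_map (measurable_Yvec_randomIndex hS hN n).aemeasurable
  refine isTightMeasureSet_of_tendsto_charFun (f := charFun (lawY : Measure E))
    continuous_charFun.continuousAt fun t => ?_
  -- `Y_{n,N_n}` is itself of the form `u Y_{n,N_n} + v` with `u = 1` and `v = 0`.
  have hu : IsTightMeasureSet (Set.range fun n : ℕ => P.map fun _ : Ω => (1 : ℝ)) :=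
    (isTightMeasureSet_range_map_iff fun n => measurable_const).2 fun ε _ =>
      ⟨1, fun r hr n => by simp [not_lt.2 hr]⟩
  have h := tendsto_charFun_sub_integral hS hN hind hcoh
    (u := fun _ _ => 1) (fun _ _ => 0) hu t
  simpa using tendsto_sub_nhds_zero_iff.1 (by simpa using h)

theorem tendsto_charFun_Zvec_sub (hS : ∀ n k, Measurable (S n k)) (hb : ∀ n k, 0 < b n k)
    (hN : ∀ n, Measurable (N n)) (hind : ∀ n k, IndepFun (N n) (S n k) P)
    (hcoh : Coherency P S a b N lawY)
    (hU : IsTightMeasureSet (Set.range fun n => P.map (Uvar b N d n))) (t : E) :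
    Tendsto (fun n => charFun (law P (Zvec S N c d n) (measurable_Zvec hS hN c d n) : Measure E) t -
      ∫ w, mixingKernel lawY t w
        ∂(law P (Wvec a b N c d n) (measurable_Wvec hN a b c d n) : Measure (ℝ × E)))
      atTop (𝓝 0) := by
  have hZ : ∀ n, (law P (Zvec S N c d n) (measurable_Zvec hS hN c d n) : Measure E) =
      P.map fun ω => Uvar b N d n ω • Yvec S a b n (N n ω) ω + Vvec a N c d n ω := fun n =>
    congrArg P.map (funext fun ω => Zvec_eq hb n ω)
  refine Tendsto.congr (fun n => ?_) <| tendsto_charFun_sub_integral hS hN hind hcoh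
    (u := fun n k => (d n)⁻¹ * b n k)
    (fun n k => (d n)⁻¹ • (a n k - c n)) hU t
  rw [hZ n, integral_mixingKernel_law_Wvec hN]
  rfl

end Scheme

end Mixing

end RandomIndex

theorem theorem2 {Ω : Type*} [MeasurableSpace Ω] (P : Measure Ω) [IsProbabilityMeasure P]
    {m : ℕ}
    (S : ℕ → ℕ → Ω → EuclideanSpace ℝ (Fin m)) (hS : ∀ n k, Measurable (S n k))
    (a : ℕ → ℕ → EuclideanSpace ℝ (Fin m))
    (b : ℕ → ℕ → ℝ) (hb : ∀ n k, 0 < b n k)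
    (d : ℕ → ℝ) (hd : ∀ n, 0 < d n)
    (N : ℕ → Ω → ℕ) (hN : ∀ n, Measurable (N n))
    (hindep : ∀ n k, IndepFun (N n) (S n k) P)
    (lawY : ProbabilityMeasure (EuclideanSpace ℝ (Fin m)))
    (Λ : ProbabilityMeasure (ℝ × EuclideanSpace ℝ (Fin m)) →
      ProbabilityMeasure (ℝ × EuclideanSpace ℝ (Fin m)) → ℝ)
    (hΛ : RandomIndex.MetrizesWeakConvergence Λ)
    (hU : RandomIndex.WeaklyRelativelyCompact (fun n : ℕ =>
      RandomIndex.law P (RandomIndex.Uvar b N d n) (RandomIndex.measurable_Uvar hN b d n)))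
    (hcoh : RandomIndex.Coherency P S a b N lawY) :
    (∀ (c : ℕ → EuclideanSpace ℝ (Fin m))
        (lawZ : ProbabilityMeasure (EuclideanSpace ℝ (Fin m))),
      Tendsto (fun n => RandomIndex.law P (RandomIndex.Zvec S N c d n)
          (RandomIndex.measurable_Zvec hS hN c d n)) atTop (𝓝 lawZ) ↔
        RandomIndex.ApproximableByMixing Λ lawZ lawY (fun n =>
          RandomIndex.law P (RandomIndex.Wvec a b N c d n)
            (RandomIndex.measurable_Wvec hN a b c d n))) ∧
    ((∃ (lawZ : ProbabilityMeasure (EuclideanSpace ℝ (Fin m)))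
        (c : ℕ → EuclideanSpace ℝ (Fin m)),
      Tendsto (fun n => RandomIndex.law P (RandomIndex.Zvec S N c d n)
          (RandomIndex.measurable_Zvec hS hN c d n)) atTop (𝓝 lawZ)) ↔
      ∃ (lawZ : ProbabilityMeasure (EuclideanSpace ℝ (Fin m)))
        (c : ℕ → EuclideanSpace ℝ (Fin m)),
        RandomIndex.ApproximableByMixing Λ lawZ lawY (fun n =>
          RandomIndex.law P (RandomIndex.Wvec a b N c d n)
            (RandomIndex.measurable_Wvec hN a b c d n))) := by
  have hUt : IsTightMeasureSet (Set.range fun n => P.map (RandomIndex.Uvar b N d n)) :=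
    hU.isTightMeasureSet
  have hmain : ∀ (c : ℕ → EuclideanSpace ℝ (Fin m))
      (lawZ : ProbabilityMeasure (EuclideanSpace ℝ (Fin m))),
      Tendsto (fun n => RandomIndex.law P (RandomIndex.Zvec S N c d n)
          (RandomIndex.measurable_Zvec hS hN c d n)) atTop (𝓝 lawZ) ↔
        RandomIndex.ApproximableByMixing Λ lawZ lawY (fun n =>
          RandomIndex.law P (RandomIndex.Wvec a b N c d n)
            (RandomIndex.measurable_Wvec hN a b c d n)) := by
    intro c lawZ
    have hdiff := RandomIndex.tendsto_charFun_Zvec_sub (c := c) hS hb hN hindep hcoh hUt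
    rw [ProbabilityMeasure.tendsto_iff_tendsto_charFun]
    constructor
    · intro hZ
      have hZt : IsTightMeasureSet (Set.range fun n => P.map (RandomIndex.Zvec S N c d n)) :=
        isTightMeasureSet_of_tendsto_charFun
          (μ := fun n => (RandomIndex.law P (RandomIndex.Zvec S N c d n)
            (RandomIndex.measurable_Zvec hS hN c d n) : Measure (EuclideanSpace ℝ (Fin m))))
          continuous_charFun.continuousAt hZ
      refine RandomIndex.approximableByMixing_of_tendsto hΛ
        (RandomIndex.weaklyRelativelyCompact_of_isTightMeasureSet
          (RandomIndex.isTightMeasureSet_Wvec hS hb hN hUt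
            (RandomIndex.isTightMeasureSet_Yvec_randomIndex hS hN hindep hcoh) hZt))
        (fun n => ?_) fun t => by simpa using (hZ t).sub (hdiff t)
      exact (ae_map_iff (RandomIndex.measurable_Wvec hN a b c d n).aemeasurable
        (measurableSet_le measurable_const measurable_fst)).2
          (.of_forall fun ω => mul_nonneg (inv_nonneg.2 (hd n).le) (hb n _).le)
    · intro hW t
      simpa using (hdiff t).add (hW.tendsto_integral_mixingKernel hΛ t)
  exact ⟨hmain, by simp_rw [hmain]⟩
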